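/- Consider an $s$-stage partitioned Runge--Kutta (PRK) method with real coefficients $b=(b_i)$, $a=(a_{ij})$, $c=(c_i)$, $B=(B_i)$, $A=(A_{ij})$, $C=(C_i)$. Applied to a Hamiltonian system $\dot q=\partial_p H(q,p,t)$, $\dot p=-\partial_q H(q,p,t)$ with $q,p\in\mathbb R^d$, one step of size $h$ from $(t_0,q_0,p_0)$ is given by $$q_1=q_0+h\sum_{i=1}^s b_i k_i,\quad k_i=\partial_pH(Q_i,P_i,t_0+c_ih),\quad Q_i=q_0+h\sum_{j=1}^s a_{ij}k_j,$$ $$p_1=p_0+h\sum_{i=1}^s B_i \ell_i,\quad \ell_i=-\partial_qH(Q_i,P_i,t_0+C_ih),\quad P_i=p_0+h\sum_{j=1}^s A_{ij}\ell_j,$$ where the stage values $k_i=k_i(h)$, $\ell_i=\ell_i(h)$ solve these (possibly implicit) equations for all small $|h|$ and are continuous at $h=0$. The method has order $r$ for a class of Hamiltonians if, for every $H$ in the class and all initial data $(t_0,q_0,p_0)$ in its domain, such stage values exist, and for every such choice of stage values and every solution $(q(t),p(t))$ of the system near $t_0$ with $(q(t_0),p(t_0))=(q_0,p_0)$, $$q_1-q(t_0+h)=O(h^{r+1}),\qquad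 p_1-p(t_0+h)=O(h^{r+1})\qquad (h\to0).$$ Let $r\le 4$ and suppose that the method has order $r$ for all autonomous separable Hamiltonians $H(q,p)=H_1(q)+H_2(p)$, where $d$ is arbitrary and $H_1,H_2$ are $C^\infty$ functions on open subsets of $\mathbb R^d$ (this property depends only on $b,a,B,A$). If $$c_i=\sum_{j=1}^s A_{ij},\qquad C_i=\sum_{j=1}^s a_{ij}\qquad(i=1,\dots,s),$$ then the method has order $r$ for all non-autonomous separable Hamiltonians $H(q,p,t)=H_1(q,t)+H_2(p,t)$, where $d$ is arbitrary and $H_1,H_2$ are $C^\infty$ functions on open subsets of $\mathbb R^d\times\mathbb R$. -/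

import Mathlib

open scoped Topology ContDiff

/-- Coefficients of an `s`-stage partitioned Runge-Kutta method: `(b, a)` are the weights and stage
coefficients for `q`, `(B, A)` those for `p`; `c` are the time nodes at which `∂H/∂p` is evaluated
and `C` the time nodes at which `∂H/∂q` is evaluated. -/
structure PRK (s : ℕ) where
  b : Fin s → ℝ
  a : Fin s → Fin s → ℝ
  c : Fin s → ℝ
  B : Fin s → ℝ
  A : Fin s → Fin s → ℝ
  C : Fin s → ℝ

/-- The partial gradient `∂H/∂q (q, p, t)`. -/
noncomputable def gradQ {d : ℕ}
    (H : EuclideanSpace ℝ (Fin d) → EuclideanSpace ℝ (Fin d) → ℝ → ℝ)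
    (q p : EuclideanSpace ℝ (Fin d)) (t : ℝ) : EuclideanSpace ℝ (Fin d) :=
  gradient (fun x => H x p t) q

/-- The partial gradient `∂H/∂p (q, p, t)`. -/
noncomputable def gradP {d : ℕ}
    (H : EuclideanSpace ℝ (Fin d) → EuclideanSpace ℝ (Fin d) → ℝ → ℝ)
    (q p : EuclideanSpace ℝ (Fin d)) (t : ℝ) : EuclideanSpace ℝ (Fin d) :=
  gradient (fun y => H q y t) p

/-- `(q, p)` solves `q' = ∂H/∂p`, `p' = -∂H/∂q` on a neighbourhood of `t₀`, with initial values
`q t₀ = q₀` and `p t₀ = p₀`. -/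
def IsHamiltonianSolution {d : ℕ}
    (H : EuclideanSpace ℝ (Fin d) → EuclideanSpace ℝ (Fin d) → ℝ → ℝ)
    (t₀ : ℝ) (q₀ p₀ : EuclideanSpace ℝ (Fin d)) (q p : ℝ → EuclideanSpace ℝ (Fin d)) : Prop :=
  q t₀ = q₀ ∧ p t₀ = p₀ ∧
    ∀ᶠ t in 𝓝 t₀, HasDerivAt q (gradP H (q t) (p t) t) t ∧
      HasDerivAt p (-gradQ H (q t) (p t) t) t

namespace PRK

variable {s d : ℕ}

/-- The internal stage `Q_i = q₀ + h ∑ⱼ a_ij kⱼ`. -/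
noncomputable def stageQ (M : PRK s) (q₀ : EuclideanSpace ℝ (Fin d)) (h : ℝ)
    (k : Fin s → EuclideanSpace ℝ (Fin d)) (i : Fin s) : EuclideanSpace ℝ (Fin d) :=
  q₀ + h • ∑ j, M.a i j • k j

/-- The internal stage `P_i = p₀ + h ∑ⱼ A_ij ℓⱼ`. -/
noncomputable def stageP (M : PRK s) (p₀ : EuclideanSpace ℝ (Fin d)) (h : ℝ)
    (l : Fin s → EuclideanSpace ℝ (Fin d)) (i : Fin s) : EuclideanSpace ℝ (Fin d) :=
  p₀ + h • ∑ j, M.A i j • l j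

/-- The (in general implicit) stage equations of one step of size `h` from `(t₀, q₀, p₀)`. -/
def StageEquations (M : PRK s)
    (H : EuclideanSpace ℝ (Fin d) → EuclideanSpace ℝ (Fin d) → ℝ → ℝ)
    (t₀ : ℝ) (q₀ p₀ : EuclideanSpace ℝ (Fin d)) (h : ℝ)
    (k l : Fin s → EuclideanSpace ℝ (Fin d)) : Prop :=
  ∀ i, k i = gradP H (M.stageQ q₀ h k i) (M.stageP p₀ h l i) (t₀ + M.c i * h) ∧
    l i = -gradQ H (M.stageQ q₀ h k i) (M.stageP p₀ h l i) (t₀ + M.C i * h)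

/-- `h ↦ (k h, l h)` solves the stage equations for all sufficiently small step sizes, and is
continuous at `h = 0` (this selects the branch of solutions of the implicit equations that
starts at the initial data). -/
def IsStageFamily (M : PRK s)
    (H : EuclideanSpace ℝ (Fin d) → EuclideanSpace ℝ (Fin d) → ℝ → ℝ)
    (t₀ : ℝ) (q₀ p₀ : EuclideanSpace ℝ (Fin d))
    (k l : ℝ → Fin s → EuclideanSpace ℝ (Fin d)) : Prop :=
  ContinuousAt k 0 ∧ ContinuousAt l 0 ∧ ∀ᶠ h in 𝓝 0, M.StageEquations H t₀ q₀ p₀ h (k h) (l h)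

/-- The new value `q₀ + h ∑ᵢ bᵢ kᵢ`. -/
noncomputable def stepQ (M : PRK s) (q₀ : EuclideanSpace ℝ (Fin d)) (h : ℝ)
    (k : Fin s → EuclideanSpace ℝ (Fin d)) : EuclideanSpace ℝ (Fin d) :=
  q₀ + h • ∑ i, M.b i • k i

/-- The new value `p₀ + h ∑ᵢ Bᵢ ℓᵢ`. -/
noncomputable def stepP (M : PRK s) (p₀ : EuclideanSpace ℝ (Fin d)) (h : ℝ)
    (l : Fin s → EuclideanSpace ℝ (Fin d)) : EuclideanSpace ℝ (Fin d) :=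
  p₀ + h • ∑ i, M.B i • l i

/-- The method, applied to `H` at `(t₀, q₀, p₀)`, is well defined for small `h` and its local
error is `O(h ^ (r + 1))` as `h → 0`. -/
def HasOrderAt (M : PRK s) (r : ℕ)
    (H : EuclideanSpace ℝ (Fin d) → EuclideanSpace ℝ (Fin d) → ℝ → ℝ)
    (t₀ : ℝ) (q₀ p₀ : EuclideanSpace ℝ (Fin d)) : Prop :=
  (∃ k l, M.IsStageFamily H t₀ q₀ p₀ k l) ∧
  ∀ k l, M.IsStageFamily H t₀ q₀ p₀ k l →
    ∀ q p, IsHamiltonianSolution H t₀ q₀ p₀ q p →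
      ((fun h : ℝ => M.stepQ q₀ h (k h) - q (t₀ + h)) =O[𝓝 0] fun h : ℝ => h ^ (r + 1)) ∧
      ((fun h : ℝ => M.stepP p₀ h (l h) - p (t₀ + h)) =O[𝓝 0] fun h : ℝ => h ^ (r + 1))

/-- Order `r` for all smooth autonomous separable Hamiltonians `H(q, p) = H₁(q) + H₂(p)`, in every
dimension, on arbitrary open domains. The time nodes `c`, `C` play no role here. -/
def HasOrderAutonomous (M : PRK s) (r : ℕ) : Prop :=
  ∀ (d : ℕ) (U V : Set (EuclideanSpace ℝ (Fin d))) (H₁ H₂ : EuclideanSpace ℝ (Fin d) → ℝ),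
    IsOpen U → IsOpen V → ContDiffOn ℝ ∞ H₁ U → ContDiffOn ℝ ∞ H₂ V →
    ∀ (t₀ : ℝ), ∀ q₀ ∈ U, ∀ p₀ ∈ V,
      M.HasOrderAt r (fun q p _ => H₁ q + H₂ p) t₀ q₀ p₀

/-- Order `r` for all smooth non-autonomous separable Hamiltonians
`H(q, p, t) = H₁(q, t) + H₂(p, t)`, in every dimension, on arbitrary open domains. -/
def HasOrderNonautonomous (M : PRK s) (r : ℕ) : Prop :=
  ∀ (d : ℕ) (U V : Set (EuclideanSpace ℝ (Fin d) × ℝ))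
    (H₁ H₂ : EuclideanSpace ℝ (Fin d) → ℝ → ℝ),
    IsOpen U → IsOpen V →
    ContDiffOn ℝ ∞ (fun x : EuclideanSpace ℝ (Fin d) × ℝ => H₁ x.1 x.2) U →
    ContDiffOn ℝ ∞ (fun x : EuclideanSpace ℝ (Fin d) × ℝ => H₂ x.1 x.2) V →
    ∀ (t₀ : ℝ) (q₀ p₀ : EuclideanSpace ℝ (Fin d)), (q₀, t₀) ∈ U → (p₀, t₀) ∈ V →
      M.HasOrderAt r (fun q p t => H₁ q t + H₂ p t) t₀ q₀ p₀

end PRK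

/-! Time is made a state variable, twice, so that separability survives. To `q` adjoin `σ, ξ`, to
`p` adjoin `π, τ`, and take the autonomous Hamiltonian `H₁(q, σ) - ξ + H₂(p, τ) + π`, with `(σ, π)`
and `(ξ, τ)` conjugate. Then `σ' = 1` and `τ' = 1`, so both are clocks started at `t₀`, while `ξ' =
∂H₂/∂τ` and `π' = -∂H₁/∂σ` are quadratures that feed back into nothing.

The method integrates both clocks with slope 1: the stages of `σ` are `t₀ + h ∑ⱼ a_ij` and those of
`τ` are `t₀ + h ∑ⱼ A_ij`. The row-sum conditions say that these are exactly `t₀ + C_i h` and `t₀ +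
c_i h`, the times at which the method samples `∂H₁/∂q` and `∂H₂/∂p` (`withTime_stageQ`,
`withTime_stageP`). Thus stage families project from the extended system (`IsStageFamily.initProj`)
and lift to it (`IsStageFamily.extend`); exact solutions lift too. The local error is then a linear
projection of the extended one. -/

namespace PRK

variable {s d : ℕ}

/-! ### Coordinates of the extended space -/

/-- The projection `ℝ^(d+2) → ℝ^d` onto the first `d` coordinates. -/
noncomputable def initProj (d : ℕ) : EuclideanSpace ℝ (Fin (d + 2)) →L[ℝ] EuclideanSpace ℝ (Fin d) :=
  LinearMap.toContinuousLinearMap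
    { toFun := fun x => WithLp.toLp 2 fun i => x (Fin.castAdd 2 i)
      map_add' := fun x y => by ext i; simp
      map_smul' := fun r x => by ext i; simp }

/-- The index of the first of the two additional coordinates of `ℝ^(d+2)`. -/
def fstIdx (d : ℕ) : Fin (d + 2) := Fin.natAdd d 0

/-- The index of the second of the two additional coordinates of `ℝ^(d+2)`. -/
def sndIdx (d : ℕ) : Fin (d + 2) := Fin.natAdd d 1

/-- The vector `(v, a, b)` of `ℝ^(d+2)`. -/
noncomputable def extend (v : EuclideanSpace ℝ (Fin d)) (a b : ℝ) :
    EuclideanSpace ℝ (Fin (d + 2)) :=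
  WithLp.toLp 2 (Fin.append v ![a, b])

@[simp] theorem initProj_apply (x : EuclideanSpace ℝ (Fin (d + 2))) (i : Fin d) :
    initProj d x i = x (Fin.castAdd 2 i) := rfl

@[simp] theorem initProj_extend (v : EuclideanSpace ℝ (Fin d)) (a b : ℝ) :
    initProj d (extend v a b) = v := by
  ext i; simp [extend]

@[simp] theorem extend_fstIdx (v : EuclideanSpace ℝ (Fin d)) (a b : ℝ) :
    extend v a b (fstIdx d) = a := by
  simp [extend, fstIdx, -Fin.natAdd_zero]

@[simp] theorem extend_sndIdx (v : EuclideanSpace ℝ (Fin d)) (a b : ℝ) :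
    extend v a b (sndIdx d) = b := by
  simp [extend, sndIdx]

theorem castAdd_ne_fstIdx (i : Fin d) : Fin.castAdd 2 i ≠ fstIdx d := by
  intro h; have := congrArg Fin.val h; simp [fstIdx] at this; omega

theorem castAdd_ne_sndIdx (i : Fin d) : Fin.castAdd 2 i ≠ sndIdx d := by
  intro h; have := congrArg Fin.val h; simp [sndIdx] at this; omega

theorem fstIdx_ne_sndIdx : fstIdx d ≠ sndIdx d := by
  intro h; have := congrArg Fin.val h; simp [fstIdx, sndIdx] at this

theorem eq_of_initProj_eq {x y : EuclideanSpace ℝ (Fin (d + 2))}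
    (h : initProj d x = initProj d y) (h₁ : x (fstIdx d) = y (fstIdx d))
    (h₂ : x (sndIdx d) = y (sndIdx d)) : x = y := by
  ext i
  refine Fin.addCases (fun j => ?_) (fun j => ?_) i
  · simpa using congrArg (fun v : EuclideanSpace ℝ (Fin d) => v j) h
  · fin_cases j
    · exact h₁
    · exact h₂

theorem extend_eq (v : EuclideanSpace ℝ (Fin d)) (a b : ℝ) :
    extend v a b = extend v 0 0 + a • EuclideanSpace.single (fstIdx d) 1
      + b • EuclideanSpace.single (sndIdx d) 1 := by
  apply eq_of_initProj_eq
  · ext i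
    simp [extend, castAdd_ne_fstIdx, castAdd_ne_sndIdx]
  · simp [fstIdx_ne_sndIdx]
  · simp [fstIdx_ne_sndIdx.symm]

/-- The inclusion `v ↦ (v, 0, 0)`. -/
noncomputable def inclCLM (d : ℕ) : EuclideanSpace ℝ (Fin d) →L[ℝ] EuclideanSpace ℝ (Fin (d + 2)) :=
  LinearMap.toContinuousLinearMap
    { toFun := fun v => extend v 0 0
      map_add' := fun x y => by apply eq_of_initProj_eq <;> simp
      map_smul' := fun r x => by apply eq_of_initProj_eq <;> simp }

theorem extend_eq_inclCLM (v : EuclideanSpace ℝ (Fin d)) (a b : ℝ) :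
    extend v a b = inclCLM d v + a • EuclideanSpace.single (fstIdx d) 1
      + b • EuclideanSpace.single (sndIdx d) 1 := extend_eq v a b

theorem continuous_extend :
    Continuous fun x : EuclideanSpace ℝ (Fin d) × ℝ × ℝ => extend x.1 x.2.1 x.2.2 := by
  simp only [extend_eq_inclCLM]
  fun_prop

theorem hasDerivAt_extend {v : ℝ → EuclideanSpace ℝ (Fin d)} {a b : ℝ → ℝ}
    {v' : EuclideanSpace ℝ (Fin d)} {a' b' t : ℝ} (hv : HasDerivAt v v' t)
    (ha : HasDerivAt a a' t) (hb : HasDerivAt b b' t) :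
    HasDerivAt (fun t => extend (v t) (a t) (b t)) (extend v' a' b') t := by
  simp only [extend_eq_inclCLM]
  exact (((inclCLM d).hasFDerivAt.comp_hasDerivAt t hv).add (ha.smul_const _)).add
    (hb.smul_const _)

/-! ### Gradients of the autonomized Hamiltonian -/

/-- The autonomous function `x ↦ H (x₁, …, x_d) x_m + ε x_n`, in which the coordinate `x_m` plays
the role of the time. -/
noncomputable def autonomize (m n : Fin (d + 2)) (ε : ℝ) (H : EuclideanSpace ℝ (Fin d) → ℝ → ℝ)
    (x : EuclideanSpace ℝ (Fin (d + 2))) : ℝ :=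
  H (initProj d x) (x m) + ε * x n

theorem gradient_coord {ι : Type*} [Fintype ι] [DecidableEq ι] (f : EuclideanSpace ℝ ι → ℝ)
    (x : EuclideanSpace ℝ ι) (i : ι) :
    gradient f x i = fderiv ℝ f x (EuclideanSpace.single i 1) := by
  have h : inner ℝ (gradient f x) (EuclideanSpace.single i (1 : ℝ))
      = fderiv ℝ f x (EuclideanSpace.single i 1) := by
    simp [gradient]
  rw [← h, EuclideanSpace.inner_single_right]
  simp

/-- The map `x ↦ ((x₁, …, x_d), x_m)`. -/
noncomputable def withTime (m : Fin (d + 2)) :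
    EuclideanSpace ℝ (Fin (d + 2)) →L[ℝ] EuclideanSpace ℝ (Fin d) × ℝ :=
  (initProj d).prod (EuclideanSpace.proj m)

@[simp] theorem withTime_apply (m : Fin (d + 2)) (x : EuclideanSpace ℝ (Fin (d + 2))) :
    withTime m x = (initProj d x, x m) := rfl

theorem fderiv_autonomize {m n : Fin (d + 2)} {ε : ℝ} {H : EuclideanSpace ℝ (Fin d) → ℝ → ℝ}
    {x : EuclideanSpace ℝ (Fin (d + 2))}
    (hH : DifferentiableAt ℝ (fun z : EuclideanSpace ℝ (Fin d) × ℝ => H z.1 z.2) (withTime m x))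
    (v : EuclideanSpace ℝ (Fin (d + 2))) :
    fderiv ℝ (autonomize m n ε H) x v =
      fderiv ℝ (fun z : EuclideanSpace ℝ (Fin d) × ℝ => H z.1 z.2) (withTime m x) (withTime m v)
        + ε * v n := by
  have h := (hH.hasFDerivAt.comp x (withTime m).hasFDerivAt).add
    ((EuclideanSpace.proj n : EuclideanSpace ℝ (Fin (d + 2)) →L[ℝ] ℝ).hasFDerivAt.const_mul ε
      (x := x))
  have h' : HasFDerivAt (autonomize m n ε H) _ x := h
  rw [h'.fderiv]
  simp

theorem gradient_autonomize_time {m n : Fin (d + 2)} {ε : ℝ}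
    {H : EuclideanSpace ℝ (Fin d) → ℝ → ℝ} {x : EuclideanSpace ℝ (Fin (d + 2))}
    (hm : ∀ i, Fin.castAdd 2 i ≠ m) (hmn : m ≠ n)
    (hH : DifferentiableAt ℝ (fun z : EuclideanSpace ℝ (Fin d) × ℝ => H z.1 z.2) (withTime m x)) :
    gradient (autonomize m n ε H) x m =
      fderiv ℝ (fun z : EuclideanSpace ℝ (Fin d) × ℝ => H z.1 z.2) (withTime m x) (0, 1) := by
  rw [gradient_coord, fderiv_autonomize hH]
  have : initProj d (EuclideanSpace.single m 1) = 0 := by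
    ext i; simp [hm i]
  simp [this, hmn.symm]

theorem gradient_autonomize_conj {m n : Fin (d + 2)} {ε : ℝ}
    {H : EuclideanSpace ℝ (Fin d) → ℝ → ℝ} {x : EuclideanSpace ℝ (Fin (d + 2))}
    (hn : ∀ i, Fin.castAdd 2 i ≠ n) (hmn : m ≠ n)
    (hH : DifferentiableAt ℝ (fun z : EuclideanSpace ℝ (Fin d) × ℝ => H z.1 z.2) (withTime m x)) :
    gradient (autonomize m n ε H) x n = ε := by
  rw [gradient_coord, fderiv_autonomize hH]
  have : initProj d (EuclideanSpace.single n 1) = 0 := by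
    ext i; simp [hn i]
  simp [this, hmn, Prod.mk_zero_zero]

theorem initProj_gradient_autonomize {m n : Fin (d + 2)} {ε : ℝ}
    {H : EuclideanSpace ℝ (Fin d) → ℝ → ℝ} {x : EuclideanSpace ℝ (Fin (d + 2))}
    (hm : ∀ i, Fin.castAdd 2 i ≠ m) (hn : ∀ i, Fin.castAdd 2 i ≠ n)
    (hH : DifferentiableAt ℝ (fun z : EuclideanSpace ℝ (Fin d) × ℝ => H z.1 z.2) (withTime m x)) :
    initProj d (gradient (autonomize m n ε H) x) =
      gradient (fun q => H q (x m)) (initProj d x) := by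
  ext i
  rw [initProj_apply, gradient_coord, fderiv_autonomize hH, gradient_coord]
  have h1 : initProj d (EuclideanSpace.single (Fin.castAdd 2 i) 1)
      = EuclideanSpace.single i (1 : ℝ) := by
    ext j; simp
  have h2 := HasFDerivAt.comp (g := fun z : EuclideanSpace ℝ (Fin d) × ℝ => H z.1 z.2)
    (initProj d x) hH.hasFDerivAt (hasFDerivAt_prodMk_left (𝕜 := ℝ) (initProj d x) (x m))
  have h2' : HasFDerivAt (fun q => H q (x m)) _ (initProj d x) := h2
  rw [h2'.fderiv]
  simp [h1, (hn i).symm, (hm i).symm]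

theorem gradQ_separable (F G : EuclideanSpace ℝ (Fin d) → ℝ → ℝ) (q p : EuclideanSpace ℝ (Fin d))
    (t : ℝ) : gradQ (fun q p t => F q t + G p t) q p t = gradient (fun x => F x t) q := by
  simp [gradQ, gradient]

theorem gradP_separable (F G : EuclideanSpace ℝ (Fin d) → ℝ → ℝ) (q p : EuclideanSpace ℝ (Fin d))
    (t : ℝ) : gradP (fun q p t => F q t + G p t) q p t = gradient (fun y => G y t) p := by
  simp [gradP, gradient]

/-- The autonomous separable Hamiltonian `H₁(q, σ) - ξ + H₂(p, τ) + π` in the extended variables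
`(q, σ, ξ)` and `(p, π, τ)`. -/
noncomputable def extendedHamiltonian (H₁ H₂ : EuclideanSpace ℝ (Fin d) → ℝ → ℝ) :
    EuclideanSpace ℝ (Fin (d + 2)) → EuclideanSpace ℝ (Fin (d + 2)) → ℝ → ℝ :=
  fun x y _ => autonomize (fstIdx d) (sndIdx d) (-1) H₁ x + autonomize (sndIdx d) (fstIdx d) 1 H₂ y

theorem gradQ_extendedHamiltonian (H₁ H₂ : EuclideanSpace ℝ (Fin d) → ℝ → ℝ)
    (x y : EuclideanSpace ℝ (Fin (d + 2))) (t : ℝ) :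
    gradQ (extendedHamiltonian H₁ H₂) x y t =
      gradient (autonomize (fstIdx d) (sndIdx d) (-1) H₁) x :=
  gradQ_separable (fun x _ => autonomize (fstIdx d) (sndIdx d) (-1) H₁ x)
    (fun y _ => autonomize (sndIdx d) (fstIdx d) 1 H₂ y) x y t

theorem gradP_extendedHamiltonian (H₁ H₂ : EuclideanSpace ℝ (Fin d) → ℝ → ℝ)
    (x y : EuclideanSpace ℝ (Fin (d + 2))) (t : ℝ) :
    gradP (extendedHamiltonian H₁ H₂) x y t =
      gradient (autonomize (sndIdx d) (fstIdx d) 1 H₂) y :=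
  gradP_separable (fun x _ => autonomize (fstIdx d) (sndIdx d) (-1) H₁ x)
    (fun y _ => autonomize (sndIdx d) (fstIdx d) 1 H₂ y) x y t

/-- The partial derivative `∂H/∂t` of a function of `(q, t)`. -/
noncomputable def timeDeriv (H : EuclideanSpace ℝ (Fin d) → ℝ → ℝ)
    (z : EuclideanSpace ℝ (Fin d) × ℝ) : ℝ :=
  fderiv ℝ (fun z : EuclideanSpace ℝ (Fin d) × ℝ => H z.1 z.2) z (0, 1)

/-- The entry `-1` comes from the term `-ξ`; after the sign change in `p' = -∂H/∂q` it makes `τ` run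
at speed 1. -/
theorem gradQ_extendedHamiltonian_eq_extend {H₁ H₂ : EuclideanSpace ℝ (Fin d) → ℝ → ℝ}
    {x y : EuclideanSpace ℝ (Fin (d + 2))} {q : EuclideanSpace ℝ (Fin d)} {σ : ℝ} (t : ℝ)
    (hx : withTime (fstIdx d) x = (q, σ))
    (hH : DifferentiableAt ℝ (fun z : EuclideanSpace ℝ (Fin d) × ℝ => H₁ z.1 z.2) (q, σ)) :
    gradQ (extendedHamiltonian H₁ H₂) x y t =
      extend (gradQ (fun q p t => H₁ q t + H₂ p t) q (initProj d y) σ)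
        (timeDeriv H₁ (q, σ)) (-1) := by
  rw [gradQ_extendedHamiltonian, gradQ_separable]
  rw [← hx] at hH ⊢
  obtain ⟨rfl, rfl⟩ := Prod.mk.inj hx
  apply eq_of_initProj_eq
  · rw [initProj_extend, initProj_gradient_autonomize castAdd_ne_fstIdx castAdd_ne_sndIdx hH]
    rfl
  · rw [extend_fstIdx, gradient_autonomize_time castAdd_ne_fstIdx fstIdx_ne_sndIdx hH, timeDeriv]
  · rw [extend_sndIdx, gradient_autonomize_conj castAdd_ne_sndIdx fstIdx_ne_sndIdx hH]

theorem gradP_extendedHamiltonian_eq_extend {H₁ H₂ : EuclideanSpace ℝ (Fin d) → ℝ → ℝ}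
    {x y : EuclideanSpace ℝ (Fin (d + 2))} {p : EuclideanSpace ℝ (Fin d)} {τ : ℝ} (t : ℝ)
    (hy : withTime (sndIdx d) y = (p, τ))
    (hH : DifferentiableAt ℝ (fun z : EuclideanSpace ℝ (Fin d) × ℝ => H₂ z.1 z.2) (p, τ)) :
    gradP (extendedHamiltonian H₁ H₂) x y t =
      extend (gradP (fun q p t => H₁ q t + H₂ p t) (initProj d x) p τ)
        1 (timeDeriv H₂ (p, τ)) := by
  rw [gradP_extendedHamiltonian, gradP_separable]
  rw [← hy] at hH ⊢
  obtain ⟨rfl, rfl⟩ := Prod.mk.inj hy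
  apply eq_of_initProj_eq
  · rw [initProj_extend, initProj_gradient_autonomize castAdd_ne_sndIdx castAdd_ne_fstIdx hH]
    rfl
  · rw [extend_fstIdx, gradient_autonomize_conj castAdd_ne_fstIdx fstIdx_ne_sndIdx.symm hH]
  · rw [extend_sndIdx, gradient_autonomize_time castAdd_ne_sndIdx fstIdx_ne_sndIdx.symm hH,
      timeDeriv]

/-! ### Stages of the extended system -/

theorem initProj_stageQ (M : PRK s) (x : EuclideanSpace ℝ (Fin (d + 2))) (h : ℝ)
    (K : Fin s → EuclideanSpace ℝ (Fin (d + 2))) (i : Fin s) :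
    initProj d (M.stageQ x h K i) = M.stageQ (initProj d x) h (fun j => initProj d (K j)) i := by
  simp [stageQ, map_sum]

theorem initProj_stageP (M : PRK s) (y : EuclideanSpace ℝ (Fin (d + 2))) (h : ℝ)
    (L : Fin s → EuclideanSpace ℝ (Fin (d + 2))) (i : Fin s) :
    initProj d (M.stageP y h L i) = M.stageP (initProj d y) h (fun j => initProj d (L j)) i := by
  simp [stageP, map_sum]

/-- A clock of slope 1 in every stage accumulates the row sum of `a`. This is where the condition on
`C` enters. -/
theorem withTime_stageQ {M : PRK s} (hC : ∀ i, M.C i = ∑ j, M.a i j)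
    (q₀ : EuclideanSpace ℝ (Fin d)) (t₀ ξ h : ℝ) {K : Fin s → EuclideanSpace ℝ (Fin (d + 2))}
    (hK : ∀ j, K j (fstIdx d) = 1) (i : Fin s) :
    withTime (fstIdx d) (M.stageQ (extend q₀ t₀ ξ) h K i) =
      (M.stageQ q₀ h (fun j => initProj d (K j)) i, t₀ + M.C i * h) := by
  rw [withTime_apply, initProj_stageQ, initProj_extend]
  simp [stageQ, hK, hC, mul_comm]

theorem withTime_stageP {M : PRK s} (hc : ∀ i, M.c i = ∑ j, M.A i j)
    (p₀ : EuclideanSpace ℝ (Fin d)) (t₀ η h : ℝ) {L : Fin s → EuclideanSpace ℝ (Fin (d + 2))}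
    (hL : ∀ j, L j (sndIdx d) = 1) (i : Fin s) :
    withTime (sndIdx d) (M.stageP (extend p₀ η t₀) h L i) =
      (M.stageP p₀ h (fun j => initProj d (L j)) i, t₀ + M.c i * h) := by
  rw [withTime_apply, initProj_stageP, initProj_extend]
  simp [stageP, hL, hc, mul_comm]

theorem tendsto_stageQ (M : PRK s) (q₀ : EuclideanSpace ℝ (Fin d))
    {k : ℝ → Fin s → EuclideanSpace ℝ (Fin d)} (hk : ContinuousAt k 0) (i : Fin s) :
    Filter.Tendsto (fun h => M.stageQ q₀ h (k h) i) (𝓝 0) (𝓝 q₀) := by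
  have hk' : ∀ j, ContinuousAt (fun h => k h j) 0 := fun j => (continuousAt_pi.1 hk) j
  have h : ContinuousAt (fun h => M.stageQ q₀ h (k h) i) 0 := by
    unfold stageQ
    fun_prop
  simpa [ContinuousAt, stageQ] using h

theorem tendsto_stageP (M : PRK s) (p₀ : EuclideanSpace ℝ (Fin d))
    {l : ℝ → Fin s → EuclideanSpace ℝ (Fin d)} (hl : ContinuousAt l 0) (i : Fin s) :
    Filter.Tendsto (fun h => M.stageP p₀ h (l h) i) (𝓝 0) (𝓝 p₀) := by
  have hl' : ∀ j, ContinuousAt (fun h => l h j) 0 := fun j => (continuousAt_pi.1 hl) j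
  have h : ContinuousAt (fun h => M.stageP p₀ h (l h) i) 0 := by
    unfold stageP
    fun_prop
  simpa [ContinuousAt, stageP] using h

/-! ### Regularity and quadrature -/

theorem tendsto_node (t₀ γ : ℝ) : Filter.Tendsto (fun h : ℝ => t₀ + γ * h) (𝓝 0) (𝓝 t₀) := by
  have h : ContinuousAt (fun h : ℝ => t₀ + γ * h) 0 := by fun_prop
  simpa [ContinuousAt] using h

theorem eventually_differentiableAt {E F : Type*} [NormedAddCommGroup E] [NormedSpace ℝ E]
    [NormedAddCommGroup F] [NormedSpace ℝ F] {f : E → F} {z : E} (hf : ContDiffAt ℝ ∞ f z) :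
    ∀ᶠ w in 𝓝 z, DifferentiableAt ℝ f w :=
  ((hf.of_le (m := 1) (by exact_mod_cast le_top)).eventually (by simp)).mono
    fun _ hw => hw.differentiableAt (by simp)

theorem continuousAt_timeDeriv {H : EuclideanSpace ℝ (Fin d) → ℝ → ℝ}
    {z : EuclideanSpace ℝ (Fin d) × ℝ}
    (hH : ContDiffAt ℝ ∞ (fun z : EuclideanSpace ℝ (Fin d) × ℝ => H z.1 z.2) z) :
    ContinuousAt (timeDeriv H) z :=
  (hH.fderiv_right (m := 0) (by exact_mod_cast le_top)).continuousAt.clm_apply continuousAt_const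

theorem eventually_continuousAt_timeDeriv {H : EuclideanSpace ℝ (Fin d) → ℝ → ℝ}
    {z : EuclideanSpace ℝ (Fin d) × ℝ}
    (hH : ContDiffAt ℝ ∞ (fun z : EuclideanSpace ℝ (Fin d) × ℝ => H z.1 z.2) z) :
    ∀ᶠ w in 𝓝 z, ContinuousAt (timeDeriv H) w :=
  ((hH.of_le (m := 1) (by exact_mod_cast le_top)).eventually (by simp)).mono
    fun _ hw => (hw.fderiv_right (m := 0) (by simp)).continuousAt.clm_apply continuousAt_const

theorem exists_primitive_nhds {φ : ℝ → ℝ} {t₀ : ℝ} (hφ : ∀ᶠ t in 𝓝 t₀, ContinuousAt φ t) :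
    ∃ ξ : ℝ → ℝ, ξ t₀ = 0 ∧ ∀ᶠ t in 𝓝 t₀, HasDerivAt ξ (φ t) t := by
  obtain ⟨ε, hε, hball⟩ := Metric.eventually_nhds_iff_ball.1 hφ
  have hcont : ContinuousOn φ (Metric.ball t₀ ε) := fun t ht => (hball t ht).continuousWithinAt
  refine ⟨fun t => ∫ u in t₀..t, φ u, by simp, ?_⟩
  filter_upwards [Metric.ball_mem_nhds t₀ hε] with t ht
  have hsub : Set.uIcc t₀ t ⊆ Metric.ball t₀ ε :=
    (convex_ball t₀ ε).ordConnected.uIcc_subset (Metric.mem_ball_self hε) ht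
  exact intervalIntegral.integral_hasDerivAt_right (hcont.mono hsub).intervalIntegrable
    (hcont.stronglyMeasurableAtFilter Metric.isOpen_ball t ht) (hball t ht)

/-! ### Transfer of stage families -/

/-- Supplies the existence of stage values for the non-autonomous system. -/
theorem IsStageFamily.initProj {M : PRK s} (hc : ∀ i, M.c i = ∑ j, M.A i j)
    (hC : ∀ i, M.C i = ∑ j, M.a i j) {H₁ H₂ : EuclideanSpace ℝ (Fin d) → ℝ → ℝ} {t₀ : ℝ}
    {q₀ p₀ : EuclideanSpace ℝ (Fin d)}
    (h₁ : ContDiffAt ℝ ∞ (fun z : EuclideanSpace ℝ (Fin d) × ℝ => H₁ z.1 z.2) (q₀, t₀))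
    (h₂ : ContDiffAt ℝ ∞ (fun z : EuclideanSpace ℝ (Fin d) × ℝ => H₂ z.1 z.2) (p₀, t₀))
    {K L : ℝ → Fin s → EuclideanSpace ℝ (Fin (d + 2))}
    (hKL : M.IsStageFamily (extendedHamiltonian H₁ H₂) t₀ (extend q₀ t₀ 0) (extend p₀ 0 t₀) K L) :
    M.IsStageFamily (fun q p t => H₁ q t + H₂ p t) t₀ q₀ p₀
      (fun h i => PRK.initProj d (K h i)) (fun h i => PRK.initProj d (L h i)) := by
  obtain ⟨hK, hL, hE⟩ := hKL
  refine ⟨continuousAt_pi.2 fun i => (PRK.initProj d).continuous.continuousAt.comp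
      (continuousAt_pi.1 hK i), continuousAt_pi.2 fun i =>
      (PRK.initProj d).continuous.continuousAt.comp (continuousAt_pi.1 hL i), ?_⟩
  have hx : withTime (fstIdx d) (extend q₀ t₀ 0) = (q₀, t₀) := by simp
  have hy : withTime (sndIdx d) (extend p₀ 0 t₀) = (p₀, t₀) := by simp
  -- The stages tend to the initial data, so for small `h` they lie where the Hamiltonian is
  -- differentiable and its gradient can be computed.
  have hQ := Filter.eventually_all.2 fun i =>
    ((((withTime (fstIdx d)).continuous.tendsto _).comp
      (tendsto_stageQ M (extend q₀ t₀ 0) hK i))).eventually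
      (hx ▸ eventually_differentiableAt h₁)
  have hP := Filter.eventually_all.2 fun i =>
    ((((withTime (sndIdx d)).continuous.tendsto _).comp
      (tendsto_stageP M (extend p₀ 0 t₀) hL i))).eventually
      (hy ▸ eventually_differentiableAt h₂)
  filter_upwards [hE, hQ, hP] with h hE hQ hP
  -- The slopes of the clocks are 1 wherever the implicit stages lie, so they are known before the
  -- stage times.
  have hK1 : ∀ i, K h i (fstIdx d) = 1 := fun i => by
    rw [(hE i).1, gradP_extendedHamiltonian_eq_extend _ rfl (hP i), extend_fstIdx]
  have hL1 : ∀ i, L h i (sndIdx d) = 1 := fun i => by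
    rw [(hE i).2, gradQ_extendedHamiltonian_eq_extend _ rfl (hQ i)]
    simp
  have hQ' : ∀ i, _ := fun i => withTime_stageQ hC q₀ t₀ 0 h hK1 i
  have hP' : ∀ i, _ := fun i => withTime_stageP hc p₀ t₀ 0 h hL1 i
  intro i
  constructor
  · have hPi := hP i
    rw [Function.comp_apply, hP' i] at hPi
    conv_lhs => beta_reduce; rw [(hE i).1, gradP_extendedHamiltonian_eq_extend _ (hP' i) hPi,
      initProj_extend, initProj_stageQ, initProj_extend]
  · have hQi := hQ i
    rw [Function.comp_apply, hQ' i] at hQi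
    conv_lhs => beta_reduce; rw [(hE i).2, gradQ_extendedHamiltonian_eq_extend _ (hQ' i) hQi, map_neg,
      initProj_extend, initProj_stageP, initProj_extend]

/-- The order bound must hold for every stage family, so each one is lifted. The slopes of `ξ` and
`π` are explicit in the given stages, so no new implicit equation has to be solved. -/
theorem IsStageFamily.extend {M : PRK s} (hc : ∀ i, M.c i = ∑ j, M.A i j)
    (hC : ∀ i, M.C i = ∑ j, M.a i j) {H₁ H₂ : EuclideanSpace ℝ (Fin d) → ℝ → ℝ} {t₀ : ℝ}
    {q₀ p₀ : EuclideanSpace ℝ (Fin d)}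
    (h₁ : ContDiffAt ℝ ∞ (fun z : EuclideanSpace ℝ (Fin d) × ℝ => H₁ z.1 z.2) (q₀, t₀))
    (h₂ : ContDiffAt ℝ ∞ (fun z : EuclideanSpace ℝ (Fin d) × ℝ => H₂ z.1 z.2) (p₀, t₀))
    {k l : ℝ → Fin s → EuclideanSpace ℝ (Fin d)}
    (hkl : M.IsStageFamily (fun q p t => H₁ q t + H₂ p t) t₀ q₀ p₀ k l) :
    M.IsStageFamily (extendedHamiltonian H₁ H₂) t₀ (extend q₀ t₀ 0) (extend p₀ 0 t₀)
      (fun h i => PRK.extend (k h i) 1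
        (timeDeriv H₂ (M.stageP p₀ h (l h) i, t₀ + M.c i * h)))
      (fun h i => PRK.extend (l h i)
        (-timeDeriv H₁ (M.stageQ q₀ h (k h) i, t₀ + M.C i * h)) 1) := by
  obtain ⟨hk, hl, hE⟩ := hkl
  have tQ : ∀ i, Filter.Tendsto (fun h => (M.stageQ q₀ h (k h) i, t₀ + M.C i * h)) (𝓝 0)
      (𝓝 (q₀, t₀)) := fun i => (tendsto_stageQ M q₀ hk i).prodMk_nhds (tendsto_node t₀ (M.C i))
  have tP : ∀ i, Filter.Tendsto (fun h => (M.stageP p₀ h (l h) i, t₀ + M.c i * h)) (𝓝 0)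
      (𝓝 (p₀, t₀)) := fun i => (tendsto_stageP M p₀ hl i).prodMk_nhds (tendsto_node t₀ (M.c i))
  have cQ : ∀ i, ContinuousAt
      (fun h => timeDeriv H₁ (M.stageQ q₀ h (k h) i, t₀ + M.C i * h)) 0 := fun i => by
    have h := (continuousAt_timeDeriv h₁).tendsto.comp (tQ i)
    simpa [ContinuousAt, stageQ, Function.comp_def] using h
  have cP : ∀ i, ContinuousAt
      (fun h => timeDeriv H₂ (M.stageP p₀ h (l h) i, t₀ + M.c i * h)) 0 := fun i => by
    have h := (continuousAt_timeDeriv h₂).tendsto.comp (tP i)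
    simpa [ContinuousAt, stageP, Function.comp_def] using h
  refine ⟨continuousAt_pi.2 fun i => ?_, continuousAt_pi.2 fun i => ?_, ?_⟩
  · exact ContinuousAt.comp (g := fun x : EuclideanSpace ℝ (Fin d) × ℝ × ℝ =>
      PRK.extend x.1 x.2.1 x.2.2) continuous_extend.continuousAt
      ((continuousAt_pi.1 hk i).prodMk (continuousAt_const.prodMk (cP i)))
  · exact ContinuousAt.comp (g := fun x : EuclideanSpace ℝ (Fin d) × ℝ × ℝ =>
      PRK.extend x.1 x.2.1 x.2.2) continuous_extend.continuousAt
      ((continuousAt_pi.1 hl i).prodMk ((cQ i).neg.prodMk continuousAt_const))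
  have hQ := Filter.eventually_all.2 fun i => (tQ i).eventually (eventually_differentiableAt h₁)
  have hP := Filter.eventually_all.2 fun i => (tP i).eventually (eventually_differentiableAt h₂)
  filter_upwards [hE, hQ, hP] with h hE hQ hP
  intro i
  have hQi := withTime_stageQ hC q₀ t₀ 0 h (K := fun i => PRK.extend (k h i) 1
    (timeDeriv H₂ (M.stageP p₀ h (l h) i, t₀ + M.c i * h))) (fun j => extend_fstIdx _ _ _) i
  have hPi := withTime_stageP hc p₀ t₀ 0 h (L := fun i => PRK.extend (l h i)
    (-timeDeriv H₁ (M.stageQ q₀ h (k h) i, t₀ + M.C i * h)) 1) (fun j => extend_sndIdx _ _ _) i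
  simp only [initProj_extend] at hQi hPi
  constructor
  · rw [gradP_extendedHamiltonian_eq_extend _ hPi (hP i), initProj_stageQ]
    simp only [initProj_extend]
    rw [← (hE i).1]
  · rw [gradQ_extendedHamiltonian_eq_extend _ hQi (hQ i), initProj_stageP]
    simp only [initProj_extend]
    conv_lhs => rw [(hE i).2]
    apply eq_of_initProj_eq <;> simp

/-! ### Lifting solutions and conclusion -/

/-- `ξ` and `η` (the coordinate `π`) are primitives along the given solution. -/
theorem exists_extend_isHamiltonianSolution {H₁ H₂ : EuclideanSpace ℝ (Fin d) → ℝ → ℝ} {t₀ : ℝ}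
    {q₀ p₀ : EuclideanSpace ℝ (Fin d)}
    (h₁ : ContDiffAt ℝ ∞ (fun z : EuclideanSpace ℝ (Fin d) × ℝ => H₁ z.1 z.2) (q₀, t₀))
    (h₂ : ContDiffAt ℝ ∞ (fun z : EuclideanSpace ℝ (Fin d) × ℝ => H₂ z.1 z.2) (p₀, t₀))
    {q p : ℝ → EuclideanSpace ℝ (Fin d)}
    (hqp : IsHamiltonianSolution (fun q p t => H₁ q t + H₂ p t) t₀ q₀ p₀ q p) :
    ∃ ξ η : ℝ → ℝ, IsHamiltonianSolution (extendedHamiltonian H₁ H₂) t₀ (extend q₀ t₀ 0)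
      (extend p₀ 0 t₀) (fun t => extend (q t) t (ξ t)) (fun t => extend (p t) (η t) t) := by
  obtain ⟨rfl, rfl, hE⟩ := hqp
  have cq : ∀ᶠ t in 𝓝 t₀, ContinuousAt (fun t => (q t, t)) t :=
    hE.mono fun t ht => ht.1.continuousAt.prodMk continuousAt_id
  have cp : ∀ᶠ t in 𝓝 t₀, ContinuousAt (fun t => (p t, t)) t :=
    hE.mono fun t ht => ht.2.continuousAt.prodMk continuousAt_id
  obtain ⟨ξ, hξ₀, hξ⟩ := exists_primitive_nhds (φ := fun t => timeDeriv H₂ (p t, t)) (t₀ := t₀) (by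
    filter_upwards [cp, cp.self_of_nhds.eventually (eventually_continuousAt_timeDeriv h₂)]
      with t ht ht'
    exact ContinuousAt.comp (f := fun t => (p t, t)) ht' ht)
  obtain ⟨η, hη₀, hη⟩ := exists_primitive_nhds (φ := fun t => -timeDeriv H₁ (q t, t)) (t₀ := t₀) (by
    filter_upwards [cq, cq.self_of_nhds.eventually (eventually_continuousAt_timeDeriv h₁)]
      with t ht ht'
    exact (ContinuousAt.comp (f := fun t => (q t, t)) ht' ht).neg)
  refine ⟨ξ, η, by simp only [hξ₀], by simp only [hη₀], ?_⟩
  filter_upwards [hE, hξ, hη, cq.self_of_nhds.eventually (eventually_differentiableAt h₁),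
    cp.self_of_nhds.eventually (eventually_differentiableAt h₂)] with t hE hξ hη hdq hdp
  constructor
  · rw [gradP_extendedHamiltonian_eq_extend (p := p t) (τ := t) t (by simp) hdp, initProj_extend]
    exact hasDerivAt_extend hE.1 (hasDerivAt_id t) hξ
  · rw [gradQ_extendedHamiltonian_eq_extend (q := q t) (σ := t) t (by simp) hdq, initProj_extend]
    convert hasDerivAt_extend hE.2 hη (hasDerivAt_id' t) using 1
    apply eq_of_initProj_eq <;> simp

theorem contDiffOn_autonomize {m n : Fin (d + 2)} {ε : ℝ} {H : EuclideanSpace ℝ (Fin d) → ℝ → ℝ}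
    {U : Set (EuclideanSpace ℝ (Fin d) × ℝ)}
    (hH : ContDiffOn ℝ ∞ (fun z : EuclideanSpace ℝ (Fin d) × ℝ => H z.1 z.2) U) :
    ContDiffOn ℝ ∞ (autonomize m n ε H) (withTime m ⁻¹' U) :=
  (hH.comp (withTime m).contDiff.contDiffOn fun _ hx => hx).add
    (contDiff_const.mul
      (EuclideanSpace.proj n : EuclideanSpace ℝ (Fin (d + 2)) →L[ℝ] ℝ).contDiff).contDiffOn

/-- A method of order `r` for autonomous separable Hamiltonians whose time nodes are the row sums
of `A` and `a` has order `r` for non-autonomous separable Hamiltonians. -/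
theorem HasOrderAutonomous.hasOrderNonautonomous {M : PRK s} {r : ℕ}
    (hM : M.HasOrderAutonomous r) (hc : ∀ i, M.c i = ∑ j, M.A i j)
    (hC : ∀ i, M.C i = ∑ j, M.a i j) : M.HasOrderNonautonomous r := by
  intro d U V H₁ H₂ hU hV hH₁ hH₂ t₀ q₀ p₀ hq₀ hp₀
  have h₁ := hH₁.contDiffAt (hU.mem_nhds hq₀)
  have h₂ := hH₂.contDiffAt (hV.mem_nhds hp₀)
  obtain ⟨⟨K, L, hKL⟩, hO⟩ : M.HasOrderAt r (extendedHamiltonian H₁ H₂) t₀ (extend q₀ t₀ 0)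
      (extend p₀ 0 t₀) :=
    hM (d + 2) (withTime (fstIdx d) ⁻¹' U) (withTime (sndIdx d) ⁻¹' V) _ _
      (hU.preimage (withTime _).continuous) (hV.preimage (withTime _).continuous)
      (contDiffOn_autonomize hH₁) (contDiffOn_autonomize hH₂) t₀ _ (by simpa using hq₀) _
      (by simpa using hp₀)
  refine ⟨⟨_, _, hKL.initProj hc hC h₁ h₂⟩, fun k l hkl q p hqp => ?_⟩
  obtain ⟨ξ, η, hsol⟩ := exists_extend_isHamiltonianSolution h₁ h₂ hqp
  obtain ⟨hq, hp⟩ := hO _ _ (hkl.extend hc hC h₁ h₂) _ _ hsol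
  constructor
  · refine Asymptotics.IsBigO.trans ?_ hq
    -- A bounded linear map sends the extended error to the original one.
    refine ((PRK.initProj d).isBigO_comp _ _).congr_left fun h => ?_
    simp [stepQ, map_sum]
  · refine Asymptotics.IsBigO.trans ?_ hp
    refine ((PRK.initProj d).isBigO_comp _ _).congr_left fun h => ?_
    simp [stepP, map_sum]

end PRK

theorem mainTheorem1 {s : ℕ} (M : PRK s) (r : ℕ) (hr : r ≤ 4)
    (hc : ∀ i, M.c i = ∑ j, M.A i j) (hC : ∀ i, M.C i = ∑ j, M.a i j)
    (hM : M.HasOrderAutonomous r) : M.HasOrderNonautonomous r :=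
  hM.hasOrderNonautonomous hc hC
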